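/- Let $K$ be a field (for instance $\mathbb{R}$, $\mathbb{C}$ or a field of rational functions $\mathbb{Q}(q,s)$), and let $q \in K$ be non-zero and not a root of unity (for instance a real $q$ with $0<|q|<1$, or an indeterminate). For $x\in K$ and integers $n\ge 0$, $0\le k\le n$ write $$(x;q)_n=\prod_{j=0}^{n-1}(1-q^jx),\qquad \begin{bmatrix} n\\ k\end{bmatrix}_q=\prod_{j=0}^{k-1}\frac{1-q^{n-j}}{1-q^{k-j}},$$ and for $s \in K$ let $$f(n,s,q)=\frac{1}{(-q;q)_n}\sum_{j=0}^n s^j\begin{bmatrix} n\\ j\end{bmatrix}_{q^2},\qquad d(n,s,q)=\det\bigl(f(i+j,s,q)\bigr)_{i,j=0}^n .$$ Then for every integer $n\ge 0$ and every $s \in K$ $$d(n,s,q)=q^{\frac{n^2(n+1)}{2}}\,\frac{\prod_{j=0}^n\left(\frac{s}{q^{2j-1}};q^2\right)_{2j}\,\prod_{j=0}^n(q;q)_j}{\prod_{j=0}^n(-q;q)_{j+n}} .$$ Moreover, the zeros of $d(n,s,q)$ in $s$ are exactly the elements $q^{\pm(2m+1)}$ with $0\le m\le n-1$. -/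

import Mathlib

/-- The `q`-Pochhammer symbol `(x; q)_n = ∏_{j=0}^{n-1} (1 - q^j x)`. -/
def qPoch {K : Type*} [Field K] (x q : K) (n : ℕ) : K :=
  ∏ j ∈ Finset.range n, (1 - q ^ j * x)

/-- The `q`-binomial coefficient
`[n, k]_q = ∏_{j=0}^{k-1} (1 - q^(n-j)) / ∏_{j=0}^{k-1} (1 - q^(k-j))`.
For `k > n` the factor `j = n` of the numerator is `0`, so the truncated subtraction is harmless. -/
def qBinom {K : Type*} [Field K] (q : K) (n k : ℕ) : K :=
  (∏ j ∈ Finset.range k, (1 - q ^ (n - j))) / ∏ j ∈ Finset.range k, (1 - q ^ (k - j))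

/-- The Rogers-Szegő polynomial `r_n(s, q) = ∑_{j=0}^n [n, j]_q s^j`. -/
def rogersSzego {K : Type*} [Field K] (n : ℕ) (s q : K) : K :=
  ∑ j ∈ Finset.range (n + 1), qBinom q n j * s ^ j

/-- The normalized Rogers-Szegő polynomial `f(n, s, q) = r_n(s, q^2) / (-q; q)_n`. -/
def normRogersSzego {K : Type*} [Field K] (n : ℕ) (s q : K) : K :=
  rogersSzego n s (q ^ 2) / qPoch (-q) q n

/-- The Hankel determinant `d(n, s, q) = det (f(i+j, s, q))_{i,j=0}^n`, of size `n + 1`. -/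
def hankelDet {K : Type*} [Field K] (n : ℕ) (s q : K) : K :=
  Matrix.det (Matrix.of fun i j : Fin (n + 1) =>
    normRogersSzego ((i : ℕ) + (j : ℕ)) s q)

/-!
The numbers `f(n, s, q)` are the moments of a linear functional `L` on polynomials, and their
three-term recurrence is the `q`-Pearson equation `L((X - 1)(X - s) w) = q L((s - q X²) w(qX))`.
Over an extension containing `a` with `s = q a²`, the weight `s - q X²` splits into linear factors,
and the equation evaluates `L(∏_{j<k} (a - q^j X) ∏_{j<m} (-a - q^j X))` in closed form: a function
of `k` times a function of `m`, divided by `(-q; q)_{k+m}`. A triangular change of basis in the rows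
and another one in the columns thus reduce the Hankel determinant to that of `1 / (-q; q)_{i+j}`,
which is essentially a Vandermonde determinant.
-/

section QPochhammer

variable {K : Type*} [Field K]

lemma qPoch_succ (x q : K) (n : ℕ) : qPoch x q (n + 1) = qPoch x q n * (1 - q ^ n * x) :=
  Finset.prod_range_succ _ _

lemma qPoch_add (x q : K) (m n : ℕ) :
    qPoch x q (m + n) = qPoch x q m * qPoch (q ^ m * x) q n := by
  simp only [qPoch, Finset.prod_range_add, pow_add, mul_assoc, mul_left_comm]

lemma qPoch_self_eq_prod_tsub (q : K) (n : ℕ) :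
    qPoch q q n = ∏ j ∈ Finset.range n, (1 - q ^ (n - j)) := by
  rw [← Finset.prod_range_reflect, qPoch]
  refine Finset.prod_congr rfl fun j hj => ?_
  have := Finset.mem_range.1 hj
  rw [show n - (n - 1 - j) = j + 1 by omega, pow_succ]

lemma one_sub_pow_ne_zero {q : K} (hq : ∀ k : ℕ, 0 < k → q ^ k ≠ 1) (k : ℕ) :
    1 - q ^ (k + 1) ≠ 0 :=
  sub_ne_zero.2 (hq _ k.succ_pos).symm

lemma one_add_pow_ne_zero {q : K} (hq : ∀ k : ℕ, 0 < k → q ^ k ≠ 1) (k : ℕ) :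
    1 + q ^ (k + 1) ≠ 0 := by
  intro h
  refine one_sub_pow_ne_zero hq (2 * k + 1) ?_
  linear_combination (1 - q ^ (k + 1)) * h

lemma qPoch_self_ne_zero {q : K} (hq : ∀ k : ℕ, 0 < k → q ^ k ≠ 1) (n : ℕ) :
    qPoch q q n ≠ 0 :=
  Finset.prod_ne_zero_iff.2 fun j _ => pow_succ q j ▸ one_sub_pow_ne_zero hq j

lemma qPoch_neg_self_ne_zero {q : K} (hq : ∀ k : ℕ, 0 < k → q ^ k ≠ 1) (n : ℕ) :
    qPoch (-q) q n ≠ 0 := by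
  refine Finset.prod_ne_zero_iff.2 fun j _ => ?_
  rw [mul_neg, sub_neg_eq_add, ← pow_succ]
  exact one_add_pow_ne_zero hq j

lemma qPoch_neg_self_succ (q : K) (n : ℕ) :
    qPoch (-q) q (n + 1) = qPoch (-q) q n * (1 + q ^ (n + 1)) := by
  rw [qPoch_succ]
  ring

lemma map_qPoch {F : Type*} [Field F] (φ : K →+* F) (x q : K) (n : ℕ) :
    φ (qPoch x q n) = qPoch (φ x) (φ q) n := by
  simp only [qPoch, map_prod, map_sub, map_one, map_mul, map_pow]

lemma qPoch_div_zpow {q : K} (hq0 : q ≠ 0) (s : K) (k : ℕ) :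
    qPoch (s / q ^ (2 * (k : ℤ) - 1)) (q ^ 2) (2 * k) =
      ∏ j ∈ Finset.range k, ((1 - q ^ (2 * j + 1) * s) * (1 - s / q ^ (2 * j + 1))) := by
  have hz : q ^ (2 * (k : ℤ) - 1) = q ^ (2 * k) / q := by
    rw [zpow_sub_one₀ hq0, div_eq_mul_inv]
    norm_cast
  rw [hz, qPoch, two_mul k, Finset.prod_range_add, ← Finset.prod_range_reflect, mul_comm,
    ← Finset.prod_mul_distrib]
  refine Finset.prod_congr rfl fun j hj => ?_
  have hj := Finset.mem_range.1 hj
  have hsplit : q ^ (k + k) = q ^ (2 * (k - 1 - j)) * q ^ (2 * j + 1) * q := by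
    rw [← pow_add, ← pow_succ]
    congr 1
    omega
  congr 2
  · rw [← pow_mul]
    field_simp
    ring
  · rw [← pow_mul, hsplit]
    field_simp

lemma qPoch_div_zpow_eq_zero_iff {q : K} (hq0 : q ≠ 0) (s : K) (k : ℕ) :
    qPoch (s / q ^ (2 * (k : ℤ) - 1)) (q ^ 2) (2 * k) = 0 ↔
      ∃ m : ℕ, m < k ∧ (s = q ^ (2 * (m : ℤ) + 1) ∨ s = q ^ (-(2 * (m : ℤ) + 1))) := by
  rw [qPoch_div_zpow hq0, Finset.prod_eq_zero_iff]
  refine exists_congr fun m => ?_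
  have h0 : q ^ (2 * m + 1) ≠ 0 := pow_ne_zero _ hq0
  have hz : q ^ (2 * (m : ℤ) + 1) = q ^ (2 * m + 1) := by norm_cast
  rw [Finset.mem_range, mul_eq_zero, sub_eq_zero, sub_eq_zero, zpow_neg, hz, or_comm,
    eq_comm (a := (1 : K)), eq_comm (a := (1 : K)), div_eq_one_iff_eq h0,
    mul_comm _ s, mul_eq_one_iff_eq_inv₀ h0]

end QPochhammer

section RogersSzego

variable {K : Type*} [Field K]

lemma qBinom_zero_right (q : K) (n : ℕ) : qBinom q n 0 = 1 := by
  simp [qBinom]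

lemma qBinom_eq_zero_of_lt (q : K) {n k : ℕ} (h : n < k) : qBinom q n k = 0 := by
  rw [qBinom, Finset.prod_eq_zero (Finset.mem_range.2 h) (by simp), zero_div]

lemma qBinom_succ_right_mul {q : K} (hq : ∀ k : ℕ, 0 < k → q ^ k ≠ 1) (n j : ℕ) :
    qBinom q n (j + 1) * (1 - q ^ (j + 1)) = qBinom q n j * (1 - q ^ (n - j)) := by
  have hj := qPoch_self_ne_zero hq j
  have hj' := one_sub_pow_ne_zero hq j
  rw [qBinom, qBinom, ← qPoch_self_eq_prod_tsub, ← qPoch_self_eq_prod_tsub,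
    Finset.prod_range_succ, qPoch_succ, ← pow_succ]
  field_simp

lemma qBinom_succ_left_mul (q : K) (n j : ℕ) :
    qBinom q (n + 1) j * (1 - q ^ (n + 1 - j)) = (1 - q ^ (n + 1)) * qBinom q n j := by
  rw [qBinom, qBinom, div_mul_eq_mul_div,
    ← Finset.prod_range_succ (fun j => 1 - q ^ (n + 1 - j)), Finset.prod_range_succ',
    mul_div_assoc', mul_comm (1 - q ^ (n + 1))]
  simp only [Nat.add_sub_add_right, Nat.sub_zero]

lemma qBinom_add_two_succ {q : K} (hq : ∀ k : ℕ, 0 < k → q ^ k ≠ 1) {n j : ℕ}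
    (hj : j ≤ n + 1) :
    qBinom q (n + 2) (j + 1) =
      qBinom q (n + 1) (j + 1) + qBinom q (n + 1) j - (1 - q ^ (n + 1)) * qBinom q n j := by
  have hsplit : q ^ (n + 1 + 1) = q ^ (n + 1 - j) * q ^ (j + 1) := by
    rw [← pow_add]
    congr 1
    omega
  have hleft := qBinom_succ_left_mul q (n + 1) j
  rw [hsplit] at hleft
  apply mul_right_cancel₀ (one_sub_pow_ne_zero hq j)
  linear_combination qBinom_succ_right_mul hq (n + 2) j + hleft -
    qBinom_succ_right_mul hq (n + 1) j - (1 - q ^ (j + 1)) * qBinom_succ_left_mul q n j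

lemma rogersSzego_eq_sum_range (s q : K) {n N : ℕ} (h : n < N) :
    rogersSzego n s q = ∑ j ∈ Finset.range N, qBinom q n j * s ^ j := by
  refine Finset.sum_subset (Finset.range_mono h) fun j _ hj => ?_
  rw [qBinom_eq_zero_of_lt q (by simpa using hj), zero_mul]

lemma rogersSzego_zero (s q : K) : rogersSzego 0 s q = 1 := by
  simp [rogersSzego, qBinom_zero_right]

lemma rogersSzego_one {q : K} (hq : q ≠ 1) (s : K) : rogersSzego 1 s q = 1 + s := by
  simp [rogersSzego, Finset.sum_range_succ, qBinom, sub_ne_zero.2 hq.symm]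

lemma rogersSzego_add_two {q : K} (hq : ∀ k : ℕ, 0 < k → q ^ k ≠ 1) (n : ℕ) (s : K) :
    rogersSzego (n + 2) s q =
      (1 + s) * rogersSzego (n + 1) s q - s * (1 - q ^ (n + 1)) * rogersSzego n s q := by
  have hshift {m : ℕ} (hm : m < n + 3) : rogersSzego m s q =
      ∑ j ∈ Finset.range (n + 2), qBinom q m (j + 1) * s ^ (j + 1) + 1 := by
    rw [rogersSzego_eq_sum_range s q hm, Finset.sum_range_succ']
    simp only [qBinom_zero_right, pow_zero, mul_one]
  have hsum : ∑ j ∈ Finset.range (n + 2), qBinom q (n + 2) (j + 1) * s ^ (j + 1) =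
      ∑ j ∈ Finset.range (n + 2), qBinom q (n + 1) (j + 1) * s ^ (j + 1) +
        s * rogersSzego (n + 1) s q - s * (1 - q ^ (n + 1)) * rogersSzego n s q := by
    rw [rogersSzego_eq_sum_range s q (show n < n + 2 by omega), rogersSzego,
      Finset.mul_sum, Finset.mul_sum, ← Finset.sum_add_distrib, ← Finset.sum_sub_distrib]
    refine Finset.sum_congr rfl fun j hj => ?_
    rw [qBinom_add_two_succ hq (Nat.lt_succ_iff.1 (Finset.mem_range.1 hj))]
    ring
  linear_combination hshift (show n + 2 < n + 3 by omega) + hsum -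
    hshift (show n + 1 < n + 3 by omega)

lemma normRogersSzego_zero (s q : K) : normRogersSzego 0 s q = 1 := by
  simp [normRogersSzego, rogersSzego_zero, qPoch]

lemma normRogersSzego_one {q : K} (hq : q ^ 2 ≠ 1) (s : K) :
    normRogersSzego 1 s q = (1 + s) / (1 + q) := by
  simp [normRogersSzego, rogersSzego_one hq, qPoch]

lemma normRogersSzego_add_two {q : K} (hq : ∀ k : ℕ, 0 < k → q ^ k ≠ 1) (n : ℕ) (s : K) :
    (1 + q ^ (n + 2)) * normRogersSzego (n + 2) s q =
      (1 + s) * normRogersSzego (n + 1) s q -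
        s * (1 - q ^ (n + 1)) * normRogersSzego n s q := by
  have hsq (k : ℕ) (hk : 0 < k) : (q ^ 2) ^ k ≠ 1 := by
    rw [← pow_mul]
    exact hq _ (by omega)
  have h0 := qPoch_neg_self_ne_zero hq n
  have h1 := one_add_pow_ne_zero hq n
  have h2 := one_add_pow_ne_zero hq (n + 1)
  simp only [normRogersSzego, qPoch_neg_self_succ, rogersSzego_add_two hsq]
  rw [show (q ^ 2) ^ (n + 1) = (q ^ (n + 1)) ^ 2 by ring]
  field_simp
  ring

lemma map_hankelDet {F : Type*} [Field F] (φ : K →+* F) (n : ℕ) (s q : K) :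
    φ (hankelDet n s q) = hankelDet n (φ s) (φ q) := by
  rw [hankelDet, RingHom.map_det, hankelDet]
  congr 1
  ext i j
  simp [normRogersSzego, rogersSzego, qBinom, map_qPoch]

end RogersSzego

section Determinants

open Polynomial Matrix

variable {R : Type*} [CommRing R]

lemma det_of_mul_mul {n : Type*} [Fintype n] [DecidableEq n] (a b : n → R) (M : Matrix n n R) :
    (of fun i j => a i * M i j * b j).det = (∏ i, a i) * M.det * ∏ i, b i := by
  rw [← det_mul_column, mul_comm, ← det_mul_row]
  simp only [of_apply, mul_comm (b _)]

lemma det_of_coeff {n : ℕ} (p : Fin n → R[X]) (hp : ∀ i, (p i).natDegree ≤ i) :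
    (of fun i j : Fin n => (p j).coeff i).det = ∏ i, (p i).coeff i :=
  det_of_isUpperTriangular (matrixOfPolynomials_blockTriangular p hp)

lemma det_of_eval {n : ℕ} (v : Fin n → R) (p : Fin n → R[X])
    (hp : ∀ i, (p i).natDegree ≤ i) :
    (of fun i j => (p j).eval (v i)).det = (vandermonde v).det * ∏ i, (p i).coeff i := by
  rw [eval_matrixOfPolynomials_eq_vandermonde_mul_matrixOfPolynomials v p hp, det_mul,
    det_of_coeff p hp]

lemma det_vandermonde_comp_rev {n : ℕ} (v : Fin n → R) :
    (vandermonde (v ∘ Fin.rev)).det = ∏ i, ∏ j ∈ Finset.Iio i, (v j - v i) := by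
  rw [det_vandermonde, ← Equiv.prod_comp Fin.revPerm]
  refine Finset.prod_congr rfl fun i _ => ?_
  rw [Fin.revPerm_apply, ← Fin.rev_rev i, ← Fin.map_revPerm_Ioi, Finset.prod_map, Fin.rev_rev]
  rfl

lemma apply_mul_eq_sum (L : R[X] →ₗ[R] R) {n : ℕ} {p r : R[X]} (hp : p.natDegree < n)
    (hr : r.natDegree < n) :
    L (p * r) = ∑ k : Fin n, ∑ l : Fin n, p.coeff k * L (X ^ (k + l : ℕ)) * r.coeff l := by
  conv_lhs => rw [p.as_sum_range_C_mul_X_pow' hp, r.as_sum_range_C_mul_X_pow' hr]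
  simp only [Finset.sum_range, Finset.sum_mul_sum, map_sum]
  refine Finset.sum_congr rfl fun k _ => Finset.sum_congr rfl fun l _ => ?_
  rw [mul_mul_mul_comm, ← C_mul, ← pow_add, ← smul_eq_C_mul, map_smul, smul_eq_mul]
  ring

lemma det_of_apply_mul (L : R[X] →ₗ[R] R) {n : ℕ} {u v : Fin n → R[X]}
    (hu : ∀ i, (u i).natDegree ≤ i) (hv : ∀ i, (v i).natDegree ≤ i) :
    (of fun i j => L (u i * v j)).det =
      (∏ i, (u i).coeff i) * (of fun i j : Fin n => L (X ^ (i + j : ℕ))).det *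
        ∏ i, (v i).coeff i := by
  have hfactor : (of fun i j => L (u i * v j)) =
      (of fun i j : Fin n => (u j).coeff i)ᵀ * (of fun i j : Fin n => L (X ^ (i + j : ℕ))) *
        of fun i j : Fin n => (v j).coeff i := by
    ext i j
    rw [of_apply, apply_mul_eq_sum L ((hu i).trans_lt i.is_lt) ((hv j).trans_lt j.is_lt),
      Finset.sum_comm]
    simp only [mul_apply, of_apply, transpose_apply, Finset.sum_mul]
  rw [hfactor, det_mul, det_mul, det_transpose, det_of_coeff u hu, det_of_coeff v hv]

end Determinants

section QPochPoly

open Polynomial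

variable {R : Type*} [CommRing R]

/-- The homogeneous `q`-shifted factorial `∏_{j<k} (a - b q^j X)`, as a polynomial in `X`. -/
noncomputable def qPochPoly (a b q : R) (k : ℕ) : R[X] :=
  ∏ j ∈ Finset.range k, (C a - C (b * q ^ j) * X)

lemma qPochPoly_succ (a b q : R) (k : ℕ) :
    qPochPoly a b q (k + 1) = qPochPoly a b q k * (C a - C (b * q ^ k) * X) :=
  Finset.prod_range_succ _ _

lemma qPochPoly_succ' (a b q : R) (k : ℕ) :
    qPochPoly a b q (k + 1) = (C a - C b * X) * (qPochPoly a b q k).comp (C q * X) := by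
  rw [qPochPoly, Finset.prod_range_succ', mul_comm, qPochPoly, prod_comp]
  congr 1
  · rw [pow_zero, mul_one]
  · refine Finset.prod_congr rfl fun j _ => ?_
    simp only [sub_comp, mul_comp, C_comp, X_comp, pow_succ, C_mul]
    ring

lemma natDegree_qPochPoly_le (a b q : R) (k : ℕ) : (qPochPoly a b q k).natDegree ≤ k := by
  refine (natDegree_prod_le _ _).trans ?_
  refine (Finset.sum_le_card_nsmul _ _ 1 fun j _ => ?_).trans (by simp)
  compute_degree

lemma coeff_qPochPoly_self (a b q : R) (k : ℕ) :
    (qPochPoly a b q k).coeff k = ∏ j ∈ Finset.range k, -(b * q ^ j) := by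
  induction k with
  | zero => simp [qPochPoly]
  | succ k ih =>
    have h0 : (qPochPoly a b q k).coeff (k + 1) = 0 :=
      coeff_eq_zero_of_natDegree_lt (Nat.lt_succ_of_le (natDegree_qPochPoly_le a b q k))
    rw [qPochPoly_succ, Finset.prod_range_succ, ← ih, mul_sub, coeff_sub, coeff_mul_C, h0,
      ← mul_assoc, coeff_mul_X, coeff_mul_C]
    ring

lemma eval_qPochPoly_one {K : Type*} [Field K] (b q y : K) (k : ℕ) :
    (qPochPoly 1 b q k).eval y = qPoch (b * y) q k := by
  simp only [qPochPoly, qPoch, eval_prod, eval_sub, eval_mul, eval_C, eval_X]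
  exact Finset.prod_congr rfl fun j _ => by ring

end QPochPoly

section ReciprocalDeterminant

open Matrix

variable {K : Type*} [Field K]

lemma prod_pow_sub_pow_mul_prod_neg (q x : K) {n a : ℕ} (ha : a ≤ n) :
    (∏ b ∈ Finset.range a, (q ^ b - q ^ a)) *
        ∏ b ∈ Finset.range a, -(q ^ (n - a) * x * q ^ b) =
      (-x * q ^ (n - 1)) ^ a * qPoch q q a := by
  have hconst : (-x * q ^ (n - 1)) ^ a = ∏ _b ∈ Finset.range a, (-x * q ^ (n - 1)) := by simp
  rw [hconst, ← Finset.prod_range_reflect, qPoch, ← Finset.prod_mul_distrib,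
    ← Finset.prod_mul_distrib]
  refine Finset.prod_congr rfl fun b hb => ?_
  have hb := Finset.mem_range.1 hb
  have hn : q ^ (n - 1) = q ^ (n - a) * q ^ b * q ^ (a - 1 - b) := by
    rw [← pow_add, ← pow_add]
    congr 1
    omega
  have ha : q ^ a = q ^ (a - 1 - b) * q ^ b * q := by
    rw [← pow_add, ← pow_succ]
    congr 1
    omega
  rw [hn, ha]
  ring

lemma inv_qPoch_eq_inv_mul_eval {q x : K} {m l j : ℕ} (hx : qPoch x q (m + l + j) ≠ 0) :
    (qPoch x q (m + l))⁻¹ =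
      (qPoch x q (m + l + j))⁻¹ * (qPochPoly 1 (q ^ l * x) q j).eval (q ^ m) := by
  have hsplit := qPoch_add x q (m + l) j
  rw [show q ^ (m + l) * x = q ^ l * x * q ^ m by ring, ← eval_qPochPoly_one] at hsplit
  rw [hsplit] at hx ⊢
  rw [mul_inv, inv_mul_cancel_right₀ (right_ne_zero_of_mul hx)]

/-- The truncated exponent `n - 1` is harmless: for `n = 0` the outer exponent is `0`. -/
lemma det_inv_qPoch {q x : K} {n : ℕ} (hx : ∀ k ≤ 2 * n, qPoch x q k ≠ 0) :
    (of fun i j : Fin (n + 1) => (qPoch x q (i + j : ℕ))⁻¹).det =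
      (-x * q ^ (n - 1)) ^ (n * (n + 1) / 2) * (∏ j ∈ Finset.range (n + 1), qPoch q q j) /
        ∏ j ∈ Finset.range (n + 1), qPoch x q (j + n) := by
  let p (j : Fin (n + 1)) : Polynomial K := qPochPoly 1 (q ^ (n - j : ℕ) * x) q j
  let v (i : Fin (n + 1)) : K := q ^ (i : ℕ)
  -- Reversing the order of rows and columns makes the entries polynomials of degree `j`.
  have hentry : (of fun i j : Fin (n + 1) => (qPoch x q (i + j : ℕ))⁻¹).submatrix
        Fin.revPerm Fin.revPerm =
      of fun i j => (qPoch x q (Fin.rev i + n : ℕ))⁻¹ *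
        (of fun i j => (p j).eval ((v ∘ Fin.rev) i)) i j := by
    ext i j
    have hrev : (Fin.rev j : ℕ) = n - j := by grind
    have hadd : (Fin.rev i + (n - j) + j : ℕ) = Fin.rev i + n := by grind
    have hne := hx (Fin.rev i + n) (by grind)
    simp only [submatrix_apply, of_apply, Fin.revPerm_apply, Function.comp_apply, p, v]
    rw [← hadd] at hne ⊢
    rw [← inv_qPoch_eq_inv_mul_eval hne, hrev]
  have hdenom : ∏ i : Fin (n + 1), (qPoch x q (Fin.rev i + n : ℕ))⁻¹ =
      (∏ j ∈ Finset.range (n + 1), qPoch x q (j + n))⁻¹ := by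
    rw [← Finset.prod_inv_distrib, Finset.prod_range]
    exact Equiv.prod_comp Fin.revPerm fun i : Fin (n + 1) => (qPoch x q (i + n : ℕ))⁻¹
  have hnumer (i : Fin (n + 1)) : (∏ j ∈ Finset.Iio i, (v j - v i)) * (p i).coeff i =
      (-x * q ^ (n - 1)) ^ (i : ℕ) * qPoch q q i := by
    rw [coeff_qPochPoly_self, ← prod_pow_sub_pow_mul_prod_neg q x (Nat.lt_succ_iff.1 i.is_lt),
      ← Nat.Iio_eq_range, ← Fin.map_valEmbedding_Iio, Finset.prod_map, Finset.prod_map]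
    rfl
  have hexp : ∑ i ∈ Finset.range (n + 1), i = n * (n + 1) / 2 := by
    rw [Finset.sum_range_id, Nat.add_sub_cancel, mul_comm]
  rw [← det_submatrix_equiv_self Fin.revPerm, hentry, det_mul_column,
    det_of_eval _ p fun j => natDegree_qPochPoly_le _ _ _ _, det_vandermonde_comp_rev, hdenom,
    ← Finset.prod_mul_distrib, Finset.prod_congr rfl fun i _ => hnumer i, Finset.prod_mul_distrib,
    Finset.prod_pow_eq_pow_sum, ← Finset.sum_range (fun i => i),
    ← Finset.prod_range (qPoch q q), hexp, div_eq_inv_mul]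

end ReciprocalDeterminant

section PearsonFunctional

open Polynomial

variable {R : Type*} [CommRing R]

/-- The `q`-Pearson equation `L((X - 1)(X - s) w) = q L((s - q X²) w(qX))` for a linear functional
`L` on polynomials, together with the relation between the moments of order `0` and `1`. It is the
functional form of the three-term recurrence of the normalized Rogers-Szegő polynomials. -/
structure IsPearson (L : R[X] →ₗ[R] R) (s q : R) : Prop where
  map_X : (1 + q) * L X = (1 + s) * L 1
  map_mul_comp (w : R[X]) :
    L ((X - 1) * (X - C s) * w) = q * L ((C s - C q * X ^ 2) * w.comp (C q * X))

/-- The polynomial `∏_{j<k} (a - q^j X) ∏_{j<m} (-a - q^j X)`. Both families of factors arise from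
the weight `s - q X²` of the `q`-Pearson equation, which splits when `s = q a²`. -/
noncomputable def mixedPoly (a q : R) (k m : ℕ) : R[X] :=
  qPochPoly a 1 q k * qPochPoly (-a) 1 q m

lemma mixedPoly_zero_zero (a q : R) : mixedPoly a q 0 0 = 1 := by
  simp [mixedPoly, qPochPoly]

lemma mixedPoly_neg (a q : R) (k m : ℕ) : mixedPoly (-a) q m k = mixedPoly a q k m := by
  rw [mixedPoly, neg_neg, mul_comm, mixedPoly]

lemma mixedPoly_succ_left (a q : R) (k m : ℕ) :
    mixedPoly a q (k + 1) m = a • mixedPoly a q k m - q ^ k • (X * mixedPoly a q k m) := by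
  simp only [mixedPoly, qPochPoly_succ, one_mul, smul_eq_C_mul]
  ring

lemma mixedPoly_succ_right (a q : R) (k m : ℕ) :
    mixedPoly a q k (m + 1) = -a • mixedPoly a q k m - q ^ m • (X * mixedPoly a q k m) := by
  rw [← mixedPoly_neg, mixedPoly_succ_left, mixedPoly_neg]

lemma weight_mul_mixedPoly_comp (a q : R) (k m : ℕ) :
    (C (q * a ^ 2) - C q * X ^ 2) * (mixedPoly a q k m).comp (C q * X) =
      -q • mixedPoly a q (k + 1) (m + 1) := by
  simp only [mixedPoly, qPochPoly_succ', mul_comp, C_mul, C_neg, C_pow, C_1, smul_eq_C_mul]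
  ring

/-- The recurrence `k ↦ k + 1` for the mixed moments `L (mixedPoly a q k m)`. -/
def MixedMomentRec (L : R[X] →ₗ[R] R) (a q : R) (k m : ℕ) : Prop :=
  (1 + q ^ (k + m + 1)) * L (mixedPoly a q (k + 1) m) =
    (a - q ^ k) * (1 - q ^ (k + 1) * a) * L (mixedPoly a q k m)

variable {L : R[X] →ₗ[R] R} {a q : R} {k m : ℕ}

lemma IsPearson.mixedMomentRec_zero_zero (hL : IsPearson L (q * a ^ 2) q) :
    MixedMomentRec L a q 0 0 := by
  rw [MixedMomentRec, mixedPoly_succ_left, mixedPoly_zero_zero, mul_one, map_sub, map_smul,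
    map_smul]
  simp only [smul_eq_mul]
  linear_combination -hL.map_X

variable [IsDomain R]

lemma MixedMomentRec.swap (hq : q ≠ 0) (h : MixedMomentRec L a q k m) :
    MixedMomentRec L (-a) q m k := by
  rw [MixedMomentRec, mixedPoly_neg, mixedPoly_neg, mixedPoly_succ_right]
  rw [MixedMomentRec, mixedPoly_succ_left] at h
  simp only [map_sub, map_smul, smul_eq_mul] at h ⊢
  apply mul_left_cancel₀ (pow_ne_zero k hq)
  linear_combination q ^ m * h

lemma IsPearson.mixedMomentRec_swap_succ (hL : IsPearson L (q * a ^ 2) q) (hq : q ≠ 0)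
    (h : MixedMomentRec L a q k m) : MixedMomentRec L (-a) q m (k + 1) := by
  set P := mixedPoly a q k m with hP
  have hpearson : L (X * (X * P)) - (1 + q * a ^ 2) * L (X * P) + q * a ^ 2 * L P =
      -q ^ 2 * L (mixedPoly a q (k + 1) (m + 1)) := by
    have hexpand : (X - 1) * (X - C (q * a ^ 2)) * P =
        X * (X * P) - (1 + q * a ^ 2) • (X * P) + (q * a ^ 2) • P := by
      simp only [smul_eq_C_mul, C_add, C_1]
      ring
    have := hL.map_mul_comp P
    rw [hexpand, weight_mul_mixedPoly_comp, map_add, map_sub] at this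
    simp only [map_smul, smul_eq_mul] at this
    linear_combination this
  have hleft : L (mixedPoly a q (k + 1) m) = a * L P - q ^ k * L (X * P) := by
    rw [mixedPoly_succ_left, map_sub, map_smul, map_smul, smul_eq_mul, smul_eq_mul]
  have hboth : L (mixedPoly a q (k + 1) (m + 1)) =
      -a ^ 2 * L P - a * (q ^ m - q ^ k) * L (X * P) + q ^ (k + m) * L (X * (X * P)) := by
    rw [mixedPoly_succ_left, mixedPoly_succ_right]
    simp only [mul_sub, mul_smul_comm, smul_sub, map_sub, map_smul, smul_eq_mul, ← hP]
    ring
  rw [MixedMomentRec, ← hP, hleft] at h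
  rw [MixedMomentRec, mixedPoly_neg, mixedPoly_neg, hleft]
  apply mul_left_cancel₀ (pow_ne_zero k hq)
  linear_combination q ^ k * hboth + q ^ (2 * k + m) * hpearson + a * q ^ m * h

lemma IsPearson.mixedMomentRec_zero_right (hL : IsPearson L (q * a ^ 2) q) (hq : q ≠ 0) :
    ∀ k, MixedMomentRec L a q k 0
  | 0 => hL.mixedMomentRec_zero_zero
  | k + 1 => by
    have h := hL.mixedMomentRec_swap_succ hq (hL.mixedMomentRec_zero_right hq k)
    simpa only [neg_neg] using h.swap hq

lemma IsPearson.mixedMomentRec (hL : IsPearson L (q * a ^ 2) q) (hq : q ≠ 0) (k : ℕ) :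
    ∀ m, MixedMomentRec L a q k m
  | 0 => hL.mixedMomentRec_zero_right hq k
  | m + 1 => by
    have hL' : IsPearson L (q * (-a) ^ 2) q := by rwa [neg_sq]
    simpa only [neg_neg] using hL'.mixedMomentRec_swap_succ hq ((hL.mixedMomentRec hq k m).swap hq)

end PearsonFunctional

section MixedMoments

open Polynomial Matrix

variable {K : Type*} [Field K]

/-- The numerator `∏_{j<k} (a - q^j) (1 - q^(j+1) a)` of the moments of a functional satisfying the
`q`-Pearson equation with `s = q a²`. -/
def momentNumer (a q : K) (k : ℕ) : K :=
  ∏ j ∈ Finset.range k, ((a - q ^ j) * (1 - q ^ (j + 1) * a))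

lemma momentNumer_succ (a q : K) (k : ℕ) :
    momentNumer a q (k + 1) = momentNumer a q k * ((a - q ^ k) * (1 - q ^ (k + 1) * a)) :=
  Finset.prod_range_succ _ _

lemma momentNumer_mul_neg {a q : K} (hq : q ≠ 0) (k : ℕ) :
    momentNumer a q k * momentNumer (-a) q k =
      (qPochPoly a 1 q k).coeff k * (qPochPoly (-a) 1 q k).coeff k *
        qPoch (q * a ^ 2 / q ^ (2 * (k : ℤ) - 1)) (q ^ 2) (2 * k) := by
  simp only [qPoch_div_zpow hq, coeff_qPochPoly_self, momentNumer, ← Finset.prod_mul_distrib]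
  refine Finset.prod_congr rfl fun j _ => ?_
  field_simp
  ring

lemma IsPearson.qPoch_mul_apply_mixedPoly {L : K[X] →ₗ[K] K} {a q : K}
    (hL : IsPearson L (q * a ^ 2) q) (hq : q ≠ 0) (k m : ℕ) :
    qPoch (-q) q (k + m) * L (mixedPoly a q k m) =
      momentNumer a q k * momentNumer (-a) q m * L 1 := by
  induction k with
  | zero =>
    induction m with
    | zero => simp [qPoch, momentNumer, mixedPoly_zero_zero]
    | succ m ih =>
      have hrec := (hL.mixedMomentRec hq 0 m).swap hq
      rw [MixedMomentRec, mixedPoly_neg, mixedPoly_neg, add_zero] at hrec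
      rw [zero_add] at ih ⊢
      rw [qPoch_neg_self_succ, momentNumer_succ]
      linear_combination qPoch (-q) q m * hrec + (-a - q ^ m) * (1 - q ^ (m + 1) * -a) * ih
  | succ k ih =>
    have hrec := hL.mixedMomentRec hq k m
    rw [MixedMomentRec] at hrec
    rw [add_right_comm, qPoch_neg_self_succ, momentNumer_succ]
    linear_combination qPoch (-q) q (k + m) * hrec + (a - q ^ k) * (1 - q ^ (k + 1) * a) * ih

lemma IsPearson.det_apply_mixedPoly {L : K[X] →ₗ[K] K} {a q : K}
    (hL : IsPearson L (q * a ^ 2) q) (hL1 : L 1 = 1) (hq0 : q ≠ 0)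
    (hq : ∀ k, qPoch (-q) q k ≠ 0) (n : ℕ) :
    (of fun i j : Fin n => L (mixedPoly a q i j)).det =
      (∏ i : Fin n, momentNumer a q i) *
        (of fun i j : Fin n => (qPoch (-q) q (i + j : ℕ))⁻¹).det *
          ∏ i : Fin n, momentNumer (-a) q i := by
  rw [← det_of_mul_mul]
  congr 1
  ext i j
  have h := hL.qPoch_mul_apply_mixedPoly hq0 i j
  rw [hL1, mul_one] at h
  rw [of_apply, of_apply, of_apply, mul_right_comm, ← h, mul_comm, inv_mul_cancel_left₀ (hq _)]

lemma IsPearson.det_apply_X_pow_add {L : K[X] →ₗ[K] K} {a q : K}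
    (hL : IsPearson L (q * a ^ 2) q) (hL1 : L 1 = 1) (hq0 : q ≠ 0)
    (hq : ∀ k, qPoch (-q) q k ≠ 0) (n : ℕ) :
    (of fun i j : Fin n => L (X ^ (i + j : ℕ))).det =
      (∏ i : Fin n, qPoch (q * a ^ 2 / q ^ (2 * (i : ℤ) - 1)) (q ^ 2) (2 * i)) *
        (of fun i j : Fin n => (qPoch (-q) q (i + j : ℕ))⁻¹).det := by
  let lead (b : K) : K := ∏ i : Fin n, (qPochPoly b 1 q i).coeff i
  have hbasis : (of fun i j : Fin n => L (mixedPoly a q i j)).det =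
      lead a * (of fun i j : Fin n => L (X ^ (i + j : ℕ))).det * lead (-a) :=
    det_of_apply_mul L (fun i => natDegree_qPochPoly_le a 1 q i)
      fun i => natDegree_qPochPoly_le (-a) 1 q i
  have hlead (b : K) : lead b ≠ 0 := by
    refine Finset.prod_ne_zero_iff.2 fun i _ => ?_
    rw [coeff_qPochPoly_self]
    exact Finset.prod_ne_zero_iff.2 fun j _ => by simp [hq0]
  have hnumer : (∏ i : Fin n, momentNumer a q i) * ∏ i : Fin n, momentNumer (-a) q i =
      lead a * lead (-a) *
        ∏ i : Fin n, qPoch (q * a ^ 2 / q ^ (2 * (i : ℤ) - 1)) (q ^ 2) (2 * i) := by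
    simp only [lead, ← Finset.prod_mul_distrib, momentNumer_mul_neg hq0]
  rw [hL.det_apply_mixedPoly hL1 hq0 hq, mul_right_comm, hnumer] at hbasis
  apply mul_left_cancel₀ (mul_ne_zero (hlead a) (hlead (-a)))
  linear_combination -hbasis

end MixedMoments

section MomentFunctional

open Polynomial

/-- The linear functional on polynomials whose `n`-th moment, the value at `X ^ n`, is `f n`. -/
noncomputable def momentFunctional {R : Type*} [CommRing R] (f : ℕ → R) : R[X] →ₗ[R] R :=
  lsum fun n => f n • LinearMap.id

lemma momentFunctional_monomial {R : Type*} [CommRing R] (f : ℕ → R) (n : ℕ) (a : R) :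
    momentFunctional f (monomial n a) = f n * a := by
  simp [momentFunctional, lsum, sum_monomial_index]

lemma momentFunctional_X_pow {R : Type*} [CommRing R] (f : ℕ → R) (n : ℕ) :
    momentFunctional f (X ^ n) = f n := by
  rw [X_pow_eq_monomial, momentFunctional_monomial, mul_one]

lemma isPearson_momentFunctional_normRogersSzego {K : Type*} [Field K] {q : K}
    (hq : ∀ k : ℕ, 0 < k → q ^ k ≠ 1) (s : K) :
    IsPearson (momentFunctional (normRogersSzego · s q)) s q where
  map_X := by
    have hX := momentFunctional_X_pow (normRogersSzego · s q) 1
    have h1 := momentFunctional_X_pow (normRogersSzego · s q) 0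
    have hne := one_add_pow_ne_zero hq 0
    rw [pow_one] at hX
    rw [pow_zero, normRogersSzego_zero] at h1
    rw [zero_add, pow_one] at hne
    rw [hX, h1, normRogersSzego_one (hq 2 two_pos), mul_div_cancel₀ _ hne, mul_one]
  map_mul_comp w := by
    induction w using Polynomial.induction_on' with
    | add p r hp hr => simp only [add_comp, mul_add, map_add, hp, hr]
    | monomial n c =>
      have hl : (X - 1) * (X - C s) * monomial n c =
          monomial (n + 2) c - monomial (n + 1) ((1 + s) * c) + monomial n (s * c) := by
        simp only [← C_mul_X_pow_eq_monomial, C_mul, C_add, C_1]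
        ring
      have hr : (C s - C q * X ^ 2) * (monomial n c).comp (C q * X) =
          monomial n (s * q ^ n * c) - monomial (n + 2) (q ^ (n + 1) * c) := by
        rw [monomial_comp]
        simp only [← C_mul_X_pow_eq_monomial, C_mul, C_pow]
        ring
      rw [hl, hr]
      simp only [map_add, map_sub, momentFunctional_monomial]
      linear_combination c * normRogersSzego_add_two hq n s

end MomentFunctional

section Evaluation

open Matrix

variable {K : Type*} [Field K]

lemma hankelDet_mul_sq {q : K} (hq0 : q ≠ 0) (hq : ∀ k : ℕ, 0 < k → q ^ k ≠ 1)
    (n : ℕ) (a : K) :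
    hankelDet n (q * a ^ 2) q =
      (∏ j ∈ Finset.range (n + 1), qPoch (q * a ^ 2 / q ^ (2 * (j : ℤ) - 1)) (q ^ 2) (2 * j)) *
        (of fun i j : Fin (n + 1) => (qPoch (-q) q (i + j : ℕ))⁻¹).det := by
  let L := momentFunctional (normRogersSzego · (q * a ^ 2) q)
  have hL : IsPearson L (q * a ^ 2) q := isPearson_momentFunctional_normRogersSzego hq _
  have hL1 : L 1 = 1 := (momentFunctional_X_pow _ 0).trans (normRogersSzego_zero _ _)
  simpa only [L, momentFunctional_X_pow, hankelDet, Finset.prod_range] using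
    hL.det_apply_X_pow_add hL1 hq0 (qPoch_neg_self_ne_zero hq) (n + 1)

lemma det_inv_qPoch_neg_self {q : K} (hq : ∀ k : ℕ, 0 < k → q ^ k ≠ 1) (n : ℕ) :
    (of fun i j : Fin (n + 1) => (qPoch (-q) q (i + j : ℕ))⁻¹).det =
      q ^ (n ^ 2 * (n + 1) / 2) * (∏ j ∈ Finset.range (n + 1), qPoch q q j) /
        ∏ j ∈ Finset.range (n + 1), qPoch (-q) q (j + n) := by
  have hpow : (- -q * q ^ (n - 1)) ^ (n * (n + 1) / 2) = q ^ (n ^ 2 * (n + 1) / 2) := by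
    cases n with
    | zero => simp
    | succ n =>
      rw [neg_neg, Nat.add_sub_cancel, ← pow_succ', ← pow_mul,
        ← Nat.mul_div_assoc _ (Nat.even_mul_succ_self _).two_dvd, ← mul_assoc, ← sq]
  rw [det_inv_qPoch fun k _ => qPoch_neg_self_ne_zero hq k, hpow]

lemma hankelDet_eq {q : K} (hq0 : q ≠ 0) (hq : ∀ k : ℕ, 0 < k → q ^ k ≠ 1) (n : ℕ) (s : K) :
    hankelDet n s q =
      q ^ (n ^ 2 * (n + 1) / 2) *
        ((∏ j ∈ Finset.range (n + 1),
            qPoch (s / q ^ (2 * (j : ℤ) - 1)) (q ^ 2) (2 * j)) *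
          ∏ j ∈ Finset.range (n + 1), qPoch q q j) /
        ∏ j ∈ Finset.range (n + 1), qPoch (-q) q (j + n) := by
  -- Both sides commute with field extensions, so `s / q` may be assumed to be a square.
  let φ := algebraMap K (AlgebraicClosure K)
  obtain ⟨a, ha⟩ := IsAlgClosed.exists_pow_nat_eq (φ s / φ q) two_pos
  have hφ0 : φ q ≠ 0 := (map_ne_zero φ).2 hq0
  have hφ (k : ℕ) (hk : 0 < k) : φ q ^ k ≠ 1 := by
    rw [← map_pow, map_ne_one_iff φ φ.injective]
    exact hq k hk
  have hs : φ q * a ^ 2 = φ s := by rw [ha, mul_div_cancel₀ _ hφ0]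
  have heval := hankelDet_mul_sq hφ0 hφ n a
  rw [det_inv_qPoch_neg_self hφ, hs, mul_div_assoc', mul_left_comm] at heval
  apply φ.injective
  simpa only [map_hankelDet, map_div₀, map_mul, map_prod, map_pow, map_zpow₀, map_qPoch, map_neg]
    using heval

end Evaluation

theorem theorem3p1 {K : Type*} [Field K] (q : K) (hq0 : q ≠ 0)
    (hq : ∀ k : ℕ, 0 < k → q ^ k ≠ 1) (n : ℕ) (s : K) :
    hankelDet n s q =
        q ^ (n ^ 2 * (n + 1) / 2) *
          ((∏ j ∈ Finset.range (n + 1),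
              qPoch (s / q ^ (2 * (j : ℤ) - 1)) (q ^ 2) (2 * j)) *
            ∏ j ∈ Finset.range (n + 1), qPoch q q j) /
          ∏ j ∈ Finset.range (n + 1), qPoch (-q) q (j + n) ∧
      (hankelDet n s q = 0 ↔
        ∃ m : ℕ, m < n ∧
          (s = q ^ (2 * (m : ℤ) + 1) ∨ s = q ^ (-(2 * (m : ℤ) + 1)))) := by
  refine ⟨hankelDet_eq hq0 hq n s, ?_⟩
  have hpow : q ^ (n ^ 2 * (n + 1) / 2) ≠ 0 := pow_ne_zero _ hq0
  have hnumer : ∏ j ∈ Finset.range (n + 1), qPoch q q j ≠ 0 :=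
    Finset.prod_ne_zero_iff.2 fun j _ => qPoch_self_ne_zero hq j
  have hdenom : ∏ j ∈ Finset.range (n + 1), qPoch (-q) q (j + n) ≠ 0 :=
    Finset.prod_ne_zero_iff.2 fun j _ => qPoch_neg_self_ne_zero hq _
  rw [hankelDet_eq hq0 hq, div_eq_zero_iff, or_iff_left hdenom, mul_eq_zero, or_iff_right hpow,
    mul_eq_zero, or_iff_left hnumer, Finset.prod_eq_zero_iff]
  simp only [qPoch_div_zpow_eq_zero_iff hq0, Finset.mem_range]
  constructor
  · rintro ⟨k, hk, m, hm, h⟩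
    exact ⟨m, by omega, h⟩
  · rintro ⟨m, hm, h⟩
    exact ⟨n, n.lt_succ_self, m, hm, h⟩
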